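/- Let $Z\subset\mathbb R^m$ be an irreducible non-singular real algebraic set, and let $M$ be a connected component of $Z$ (for the Euclidean topology) whose dimension $d$ is maximal among the dimensions of the connected components of $Z$. Suppose that there exist an irreducible real algebraic set $Y\subset\mathbb R^p$ of dimension $d$ and a rational map $\varphi=(\varphi_1,\dots,\varphi_m):\mathbb R^p\dashrightarrow\mathbb R^m$, $\varphi_i\in\mathbb R(x_1,\dots,x_p)$, such that $\varphi$ restricts to a bijection from $Y\cap\operatorname{dom}(\varphi)$ onto $M$, where $\operatorname{dom}(\varphi)$ is the set of points at which every $\varphi_i$ is defined (in particular, this holds if $\varphi$ is defined at every point of $Y$ and $\varphi|_Y:Y\to M$ is bijective). Then $M$ is the only connected component of $Z$ of dimension $d$. Here an algebraic set is irreducible if it is non-empty and not the union of two proper algebraic subsets; the dimension of $S\subset\mathbb R^n$ is the Krull dimension of $\mathbb R[x_1,\dots,x_n]/I(S)$, where $I(S)$ is the ideal of polynomials vanishing on $S$; $Z$ is non-singular if at each $x\in Z$ the gradients $\nabla P(x)$, $P\in I(Z)$, span a space of dimension $m-\dim Z$; and a rational function is defined at $x$ if it can be written as $a/b$ with polynomials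 $a,b$ and $b(x)\neq0$. -/

import Mathlib

namespace RealAlg

open MvPolynomial

/-- Real algebraic subsets of `ℝⁿ`: common zero sets of ideals of real polynomials. -/
def IsAlgebraicSet {n : ℕ} (V : Set (Fin n → ℝ)) : Prop :=
  ∃ I : Ideal (MvPolynomial (Fin n) ℝ), V = zeroLocus ℝ I

/-- An irreducible algebraic set: non-empty, and not the union of two proper algebraic subsets. -/
structure IsIrreducibleAlgebraicSet {n : ℕ} (V : Set (Fin n → ℝ)) : Prop where
  isAlgebraic : IsAlgebraicSet V
  nonempty : V.Nonempty
  eq_or_eq_of_union : ∀ A B : Set (Fin n → ℝ),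
    IsAlgebraicSet A → IsAlgebraicSet B → V = A ∪ B → V = A ∨ V = B

/-- The dimension of a (semialgebraic) subset `S` of `ℝⁿ`: the Krull dimension of the ring
`ℝ[x₁, …, xₙ] / I(S)` of polynomial functions on `S`. -/
noncomputable def dim {n : ℕ} (S : Set (Fin n → ℝ)) : WithBot ℕ∞ :=
  ringKrullDim (MvPolynomial (Fin n) ℝ ⧸ vanishingIdeal ℝ S)

/-- The gradient of a polynomial at a point. -/
noncomputable def gradientAt {n : ℕ} (x : Fin n → ℝ) (P : MvPolynomial (Fin n) ℝ) : Fin n → ℝ :=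
  fun i => eval x (pderiv i P)

/-- The rank at `x` of the Jacobian matrix of (any system of generators of) the ideal `I(V)`:
the dimension of the space spanned by the gradients at `x` of the polynomials in `I(V)`. -/
noncomputable def jacobianRank {n : ℕ} (V : Set (Fin n → ℝ)) (x : Fin n → ℝ) : ℕ :=
  Module.finrank ℝ
    (Submodule.span ℝ (gradientAt x '' (vanishingIdeal ℝ V : Set (MvPolynomial (Fin n) ℝ))))

/-- `V ⊆ ℝⁿ` is non-singular: at each of its points the Jacobian rank is `n - dim V`. -/
def IsNonsingular {n : ℕ} (V : Set (Fin n → ℝ)) : Prop :=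
  ∀ x ∈ V, (jacobianRank V x : WithBot ℕ∞) + dim V = (n : WithBot ℕ∞)

/-- `M` is a connected component of `Z` for the Euclidean topology. -/
def IsConnectedComponentOf {n : ℕ} (M Z : Set (Fin n → ℝ)) : Prop :=
  ∃ x ∈ Z, M = connectedComponentIn Z x

/-- The field `ℝ(x₁, …, xₚ)` of rational functions. -/
abbrev RationalFunction (p : ℕ) : Type := FractionRing (MvPolynomial (Fin p) ℝ)

/-- `a / b` is a representation of `f` whose denominator does not vanish at `x`. -/
def IsRepresentationAt {p : ℕ} (f : RationalFunction p) (x : Fin p → ℝ)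
    (ab : MvPolynomial (Fin p) ℝ × MvPolynomial (Fin p) ℝ) : Prop :=
  eval x ab.2 ≠ 0 ∧
    f = algebraMap _ (RationalFunction p) ab.1 / algebraMap _ (RationalFunction p) ab.2

/-- The rational function `f` is defined at `x`. -/
def IsDefinedAt {p : ℕ} (f : RationalFunction p) (x : Fin p → ℝ) : Prop :=
  ∃ ab, IsRepresentationAt f x ab

open Classical in
/-- The value of a rational function at a point where it is defined (and `0` elsewhere). -/
noncomputable def value {p : ℕ} (f : RationalFunction p) (x : Fin p → ℝ) : ℝ :=
  if h : IsDefinedAt f x then eval x h.choose.1 / eval x h.choose.2 else 0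

/-- The value does not depend on the representation. -/
theorem value_eq {p : ℕ} {f : RationalFunction p} {x : Fin p → ℝ}
    {ab : MvPolynomial (Fin p) ℝ × MvPolynomial (Fin p) ℝ} (h : IsRepresentationAt f x ab) :
    value f x = eval x ab.1 / eval x ab.2 := by
  have hd : IsDefinedAt f x := ⟨ab, h⟩
  rw [value, dif_pos hd]
  have h' := hd.choose_spec
  generalize hd.choose = cd at h' ⊢
  obtain ⟨hb, hf⟩ := h
  obtain ⟨hc, hf'⟩ := h'
  have inj := IsFractionRing.injective (MvPolynomial (Fin p) ℝ) (RationalFunction p)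
  have key : ∀ q : MvPolynomial (Fin p) ℝ, eval x q ≠ 0 →
      algebraMap _ (RationalFunction p) q ≠ 0 := by
    intro q hq h0
    have : q = 0 := inj (by rw [h0, map_zero])
    exact hq (by rw [this, map_zero])
  rw [hf, div_eq_div_iff (key _ hb) (key _ hc), ← map_mul, ← map_mul] at hf'
  have h2 := congrArg (eval x) (inj hf')
  rw [map_mul, map_mul] at h2
  rw [div_eq_div_iff hc hb, h2]

/-- A rational map `ℝᵖ ⇢ ℝᵐ`: an `m`-tuple of rational functions on `ℝᵖ`. -/
abbrev RationalMap (p m : ℕ) : Type := Fin m → RationalFunction p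

/-- The domain of a rational map: the points at which all its components are defined. -/
def RationalMap.domain {p m : ℕ} (φ : RationalMap p m) : Set (Fin p → ℝ) :=
  {x | ∀ i, IsDefinedAt (φ i) x}

/-- The map that a rational map defines on its domain. -/
noncomputable def RationalMap.toFun {p m : ℕ} (φ : RationalMap p m) (x : Fin p → ℝ) :
    Fin m → ℝ :=
  fun i => value (φ i) x

end RealAlg

/-! ### Generically finite extensions of domains and their primitive elements -/

namespace RealAlg

open Polynomial

/-! The heart is a parity argument. Once `M` and another component `N` of dimension `d` are known to
be Zariski dense in `Z`, let `A` be the coordinate ring of `Z` and `B` the ring of regular functions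
on `Y ∩ dom φ`. Density of `M` makes the comorphism `A → B` injective, and equal dimensions make it
algebraic. After inverting some `h ≠ 0` in `A`, `B` becomes `A[T]/(G)` with `G` separable
(`exists_genericPrimitive`). Real points of `B` over a point `ζ` of `Z` with `h(ζ) ≠ 0` are then the
real roots of the specialization of `G` at `ζ`, which are simple, and the degree does not depend on
`ζ`. Over a point of `M` there is exactly one real root, so this degree is odd. Hence there is a
real root over a point of `N` too (`exists_real_point_over`), that is, a point of `Y ∩ dom φ`
mapping into `N`. Its image also lies in `M`, so the two components meet and coincide.

Density follows from `dim Z = d`: a proper algebraic subset of `Z` has smaller dimension. To compare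
`dim Z` with the dimensions of the components, `exists_component_vanishingIdeal_eq` finds one dense
component. Noether normalization, a primitive element and the implicit function theorem give a
continuous section of a projection of `Z` over a ball, whose connected image is already Zariski
dense. -/

/-- Pseudo-division of polynomials over a commutative ring. -/
theorem exists_pseudo_division {A : Type*} [CommRing A] [IsDomain A] (G : A[X]) (hG : G ≠ 0)
    (Q : A[X]) :
    ∃ (k : ℕ) (R S : A[X]), C (G.leadingCoeff ^ k) * Q = G * R + S ∧ S.degree < G.degree := by
  induction hn : Q.natDegree using Nat.strong_induction_on generalizing Q with
  | _ n ih =>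
    by_cases hd : Q.degree < G.degree
    · exact ⟨0, 0, Q, by simp, hd⟩
    by_cases hQ0 : Q = 0
    · exact ⟨0, 0, 0, by simp [hQ0], by simpa [bot_lt_iff_ne_bot] using hG⟩
    have hle : G.natDegree ≤ Q.natDegree := natDegree_le_natDegree (not_lt.mp hd)
    set P : A[X] := C G.leadingCoeff * Q - G * (C Q.leadingCoeff * X ^ (Q.natDegree - G.natDegree))
      with hP
    have hc : G.leadingCoeff ≠ 0 := leadingCoeff_ne_zero.mpr hG
    have hq : Q.leadingCoeff ≠ 0 := leadingCoeff_ne_zero.mpr hQ0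
    have hlt : P.degree < Q.degree := by
      have h1 : (C G.leadingCoeff * Q).degree = Q.degree := by
        rw [degree_mul, degree_C hc, zero_add]
      rw [← h1]
      apply degree_sub_lt_left
      · rw [h1, degree_mul, degree_C_mul_X_pow _ hq, degree_eq_natDegree hG,
          degree_eq_natDegree hQ0, ← Nat.cast_add]
        congr 1
        omega
      · exact mul_ne_zero (C_ne_zero.mpr hc) hQ0
      · rw [leadingCoeff_mul, leadingCoeff_mul, leadingCoeff_C, leadingCoeff_C_mul_X_pow]
    have hfin : ∃ (k : ℕ) (R S : A[X]),
        C (G.leadingCoeff ^ k) * P = G * R + S ∧ S.degree < G.degree := by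
      by_cases hP0 : P = 0
      · exact ⟨0, 0, 0, by simp [hP0], by simpa [bot_lt_iff_ne_bot] using hG⟩
      · exact ih _ (hn ▸ natDegree_lt_natDegree hP0 hlt) P rfl
    obtain ⟨k, R, S, h1, h2⟩ := hfin
    refine ⟨k + 1, R + C (G.leadingCoeff ^ k) *
      (C Q.leadingCoeff * X ^ (Q.natDegree - G.natDegree)), S, ?_, h2⟩
    have : C (G.leadingCoeff ^ (k + 1)) * Q = C (G.leadingCoeff ^ k) * P +
        G * (C (G.leadingCoeff ^ k) *
          (C Q.leadingCoeff * X ^ (Q.natDegree - G.natDegree))) := by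
      rw [hP, pow_succ, C_mul]; ring
    rw [this, h1]; ring

/-- An element `θ` of an extension `A → B` of domains, together with a polynomial `G` over `A`,
such that after inverting `h` the algebra `B` becomes `A[T] / (G)`, étale over `A`. -/
structure GenericPrimitive (A B : Type*) [CommRing A] [CommRing B] [Algebra A B] where
  /-- The element of the base to be inverted. -/
  h : A
  /-- The primitive element. -/
  θ : B
  /-- The equation of the primitive element. -/
  G : A[X]
  h_ne_zero : h ≠ 0
  aeval_G : aeval θ G = 0
  leadingCoeff_dvd : G.leadingCoeff ∣ h
  coprime : ∃ U V : A[X], U * G + V * derivative G = C h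
  mul_eq_of_aeval_eq_zero : ∀ Q : A[X], aeval θ Q = 0 → ∃ (k : ℕ) (R : A[X]), C (h ^ k) * Q = G * R
  exists_aeval_eq : ∀ b : B, ∃ (k : ℕ) (Q : A[X]), algebraMap A B (h ^ k) * b = aeval θ Q

namespace GenericPrimitive

variable {A B : Type*} [CommRing A] [CommRing B] [Algebra A B] (D : GenericPrimitive A B)
variable {F : Type*} [Field F] (ζ : A →+* F)

theorem leadingCoeff_ne_zero (hζ : ζ D.h ≠ 0) : ζ D.G.leadingCoeff ≠ 0 := by
  obtain ⟨c, hc⟩ := D.leadingCoeff_dvd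
  rw [hc, map_mul] at hζ
  exact left_ne_zero_of_mul hζ

theorem natDegree_map (hζ : ζ D.h ≠ 0) : (D.G.map ζ).natDegree = D.G.natDegree :=
  natDegree_map_of_leadingCoeff_ne_zero ζ (D.leadingCoeff_ne_zero ζ hζ)

/-- The Bézout identity between `G` and its derivative specializes, and its right-hand side `h`
becomes invertible. -/
theorem separable_map (hζ : ζ D.h ≠ 0) : (D.G.map ζ).Separable := by
  obtain ⟨U, V, h⟩ := D.coprime
  have := congrArg (Polynomial.map ζ) h
  simp only [Polynomial.map_add, Polynomial.map_mul, map_C] at this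
  refine ⟨C (ζ D.h)⁻¹ * U.map ζ, C (ζ D.h)⁻¹ * V.map ζ, ?_⟩
  rw [derivative_map, mul_assoc, mul_assoc, ← mul_add, this, ← C_mul, inv_mul_cancel₀ hζ, C_1]

/-- Up to a power of `h`, every relation satisfied by `θ` is a multiple of `G`. This is what makes
the value of an element of `B` at `(ζ, t)` independent of how it is written in terms of `θ`. -/
theorem eval₂_eq_zero (hζ : ζ D.h ≠ 0) {t : F} (ht : D.G.eval₂ ζ t = 0) {Q : A[X]}
    (hQ : aeval D.θ Q = 0) : Q.eval₂ ζ t = 0 := by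
  obtain ⟨k, R, h⟩ := D.mul_eq_of_aeval_eq_zero Q hQ
  have := congrArg (Polynomial.eval₂ ζ t) h
  rw [eval₂_mul, eval₂_mul, ht, zero_mul, eval₂_C, map_pow] at this
  exact (mul_eq_zero.mp this).resolve_left (pow_ne_zero _ hζ)

/-- The value at the point `(ζ, t)` of an element of `B`. -/
noncomputable def pointValue (t : F) (b : B) : F :=
  (D.exists_aeval_eq b).choose_spec.choose.eval₂ ζ t / ζ D.h ^ (D.exists_aeval_eq b).choose

theorem pointValue_eq (hζ : ζ D.h ≠ 0) {t : F} (ht : D.G.eval₂ ζ t = 0) {b : B} {k : ℕ} {Q : A[X]}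
    (h : algebraMap A B (D.h ^ k) * b = aeval D.θ Q) :
    D.pointValue ζ t b = Q.eval₂ ζ t / ζ D.h ^ k := by
  have h' := (D.exists_aeval_eq b).choose_spec.choose_spec
  rw [pointValue]
  generalize (D.exists_aeval_eq b).choose_spec.choose = Q' at h' ⊢
  generalize (D.exists_aeval_eq b).choose = k' at h' ⊢
  have hz : aeval D.θ (C (D.h ^ k) * Q' - C (D.h ^ k') * Q) = 0 := by
    simp only [map_sub, map_mul, aeval_C, ← h, ← h']; ring
  have := D.eval₂_eq_zero ζ hζ ht hz
  rw [eval₂_sub, eval₂_mul, eval₂_mul, eval₂_C, eval₂_C, sub_eq_zero, map_pow, map_pow] at this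
  rw [div_eq_div_iff (pow_ne_zero _ hζ) (pow_ne_zero _ hζ), mul_comm, this, mul_comm]

/-- The point of `B` over `ζ` given by a root of the specialized equation. -/
noncomputable def point (hζ : ζ D.h ≠ 0) {t : F} (ht : D.G.eval₂ ζ t = 0) : B →+* F where
  toFun := D.pointValue ζ t
  map_one' := by
    rw [D.pointValue_eq ζ hζ ht (b := 1) (k := 0) (Q := 1) (by simp)]; simp
  map_zero' := by
    rw [D.pointValue_eq ζ hζ ht (b := 0) (k := 0) (Q := 0) (by simp)]; simp
  map_mul' x y := by
    obtain ⟨k, Q, h⟩ := D.exists_aeval_eq x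
    obtain ⟨k', Q', h'⟩ := D.exists_aeval_eq y
    rw [D.pointValue_eq ζ hζ ht h, D.pointValue_eq ζ hζ ht h',
      D.pointValue_eq ζ hζ ht (b := x * y) (k := k + k') (Q := Q * Q')
        (by rw [map_mul, ← h, ← h', pow_add, map_mul]; ring), eval₂_mul, pow_add,
        div_mul_div_comm]
  map_add' x y := by
    obtain ⟨k, Q, h⟩ := D.exists_aeval_eq x
    obtain ⟨k', Q', h'⟩ := D.exists_aeval_eq y
    rw [D.pointValue_eq ζ hζ ht h, D.pointValue_eq ζ hζ ht h',
      D.pointValue_eq ζ hζ ht (b := x + y) (k := k + k')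
        (Q := C (D.h ^ k') * Q + C (D.h ^ k) * Q')
        (by rw [map_add, map_mul, map_mul, ← h, ← h', pow_add, map_mul, aeval_C, aeval_C]; ring),
        div_add_div _ _ (pow_ne_zero _ hζ) (pow_ne_zero _ hζ)]
    rw [eval₂_add, eval₂_mul, eval₂_mul, eval₂_C, eval₂_C, map_pow, map_pow, pow_add]
    ring

theorem point_algebraMap (hζ : ζ D.h ≠ 0) {t : F} (ht : D.G.eval₂ ζ t = 0) (a : A) :
    D.point ζ hζ ht (algebraMap A B a) = ζ a := by
  change D.pointValue ζ t _ = _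
  rw [D.pointValue_eq ζ hζ ht (k := 0) (Q := C a) (by simp)]; simp

theorem point_θ (hζ : ζ D.h ≠ 0) {t : F} (ht : D.G.eval₂ ζ t = 0) :
    D.point ζ hζ ht D.θ = t := by
  change D.pointValue ζ t _ = _
  rw [D.pointValue_eq ζ hζ ht (k := 0) (Q := X) (by simp)]; simp

/-- A point of `B` gives a root of the equation specialized at its image. -/
theorem eval₂_G_eq_zero (β : B →+* F) : D.G.eval₂ (β.comp (algebraMap A B)) (β D.θ) = 0 := by
  rw [← hom_eval₂, ← aeval_def, D.aeval_G, map_zero]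

end GenericPrimitive

section Existence

theorem exists_C_mul_eq_map {A K : Type*} [CommRing A] [Field K] [Algebra A K]
    [IsDomain A] [IsFractionRing A K] (q : K[X]) :
    ∃ (a : A) (Q : A[X]), a ≠ 0 ∧ Q.map (algebraMap A K) = C (algebraMap A K a) * q := by
  obtain ⟨b, hb, h⟩ := IsLocalization.integerNormalization_spec (nonZeroDivisors A) q
  refine ⟨b, IsLocalization.integerNormalization (nonZeroDivisors A) q,
    nonZeroDivisors.ne_zero hb, ?_⟩
  rw [h, ← algebraMap_smul K b q, smul_eq_C_mul]

/-- `L` is algebraic and finitely generated as a field over `K`, hence finite. -/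
theorem finiteDimensional_of_isFractionRing (A B : Type*) [CommRing A] [IsDomain A] [CommRing B]
    [IsDomain B] [Algebra A B] [Algebra.IsAlgebraic A B] [Algebra.FiniteType A B] (K L : Type*)
    [Field K] [Field L] [Algebra A K] [IsFractionRing A K] [Algebra B L] [IsFractionRing B L]
    [Algebra K L] [Algebra A L]
    [IsScalarTower A B L] [IsScalarTower A K L] : FiniteDimensional K L := by
  have : Algebra.IsAlgebraic B L := IsLocalization.isAlgebraic L (nonZeroDivisors B)
  have : Algebra.IsAlgebraic A L := Algebra.IsAlgebraic.trans A B L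
  have : Algebra.IsAlgebraic K L := (IsFractionRing.comap_isAlgebraic_iff (A := A)).mp this
  have : Algebra.EssFiniteType A L := by
    have : Algebra.EssFiniteType B L :=
      Algebra.EssFiniteType.of_isLocalization _ (nonZeroDivisors B)
    exact Algebra.EssFiniteType.comp A B L
  have : Algebra.EssFiniteType K L := Algebra.EssFiniteType.of_comp A K L
  obtain ⟨s, hs⟩ := IntermediateField.fg_top K L
  have : FiniteDimensional K (IntermediateField.adjoin K (s : Set L)) :=
    IntermediateField.finiteDimensional_adjoin fun x _ => Algebra.IsIntegral.isIntegral x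
  rw [hs] at this
  exact IntermediateField.topEquiv.toLinearEquiv.finiteDimensional

variable (A B : Type*) [CommRing A] [IsDomain A] [CommRing B] [IsDomain B] [Algebra A B]
  [Algebra.IsAlgebraic A B] [Algebra.FiniteType A B] [CharZero A]

theorem exists_primitive_element_mem (K L : Type*) [Field K] [Field L] [Algebra A K]
    [IsFractionRing A K] [Algebra B L] [IsFractionRing B L] [Algebra K L] [Algebra A L]
    [IsScalarTower A B L] [IsScalarTower A K L] :
    ∃ θ : B, Algebra.adjoin K {algebraMap B L θ} = ⊤ := by
  have : FiniteDimensional K L := finiteDimensional_of_isFractionRing A B K L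
  have : CharZero K := charZero_of_injective_algebraMap (IsFractionRing.injective A K)
  obtain ⟨α, hα⟩ := Field.exists_primitive_element K L
  obtain ⟨x, y, hy, rfl⟩ := IsFractionRing.div_surjective (A := B) α
  have hy0 : y ≠ 0 := nonZeroDivisors.ne_zero hy
  have hyA : IsAlgebraic A y := Algebra.IsAlgebraic.isAlgebraic y
  -- The denominator `y` divides a nonzero `r` of `A`, say `r = y * c`. Then `x / y = (x * c) / r`
  -- with `r` invertible in `K`, so `x * c` is a primitive element lying in `B`.
  obtain ⟨r, hr, c, hc⟩ := hyA.exists_nonzero_dvd hy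
  refine ⟨x * c, ?_⟩
  have hr' : algebraMap A K r ≠ 0 := by simpa using hr
  have key : algebraMap B L x / algebraMap B L y =
      (algebraMap A K r)⁻¹ • algebraMap B L (x * c) := by
    rw [eq_inv_smul_iff₀ hr', Algebra.smul_def, ← IsScalarTower.algebraMap_apply,
      IsScalarTower.algebraMap_apply A B, hc, map_mul, map_mul]
    have : algebraMap B L y ≠ 0 := by simpa using hy0
    field_simp
  rw [eq_top_iff, ← IntermediateField.top_toSubalgebra, ← hα,
    IntermediateField.adjoin_simple_toSubalgebra_of_isAlgebraic (IsAlgebraic.of_finite K _)]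
  refine Algebra.adjoin_le (Set.singleton_subset_iff.mpr ?_)
  rw [key]
  exact Subalgebra.smul_mem _ (Algebra.subset_adjoin (Set.mem_singleton _)) _

/-- Everything holds over the fraction fields, with the minimal polynomial of a primitive element as
equation. Only finitely many denominators have to be cleared, since `B` is finitely generated. -/
theorem exists_genericPrimitive [FaithfulSMul A B] : Nonempty (GenericPrimitive A B) := by
  classical
  let := FractionRing.liftAlgebra A (FractionRing B)
  have := FractionRing.isScalarTower_liftAlgebra A (FractionRing B)
  obtain ⟨θ, hθ⟩ := exists_primitive_element_mem A B (FractionRing A) (FractionRing B)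
  set K := FractionRing A
  set L := FractionRing B
  set τ : L := algebraMap B L θ with hτ
  have hinj : Function.Injective (algebraMap A K) := IsFractionRing.injective A K
  have hinjL : Function.Injective (algebraMap B L) := IsFractionRing.injective B L
  have : CharZero K := inferInstance
  have hint : IsIntegral K τ := Algebra.IsIntegral.isIntegral τ
  have haev : ∀ Q : A[X], algebraMap B L (aeval θ Q) = aeval τ (Q.map (algebraMap A K)) := by
    intro Q
    rw [aeval_map_algebraMap, hτ, aeval_algebraMap_apply]
  obtain ⟨a, G, ha, hG⟩ := exists_C_mul_eq_map (A := A) (minpoly K τ)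
  have haK : algebraMap A K a ≠ 0 := by simpa using ha
  have hG0 : G ≠ 0 := by
    rintro rfl
    rw [Polynomial.map_zero, eq_comm, mul_eq_zero, C_eq_zero] at hG
    exact hG.elim haK (minpoly.ne_zero hint)
  have hGθ : aeval θ G = 0 := by
    apply hinjL
    rw [haev, hG, map_mul, minpoly.aeval, mul_zero, map_zero]
  have hdeg : G.degree = (minpoly K τ).degree := by
    rw [← degree_map_eq_of_injective hinj G, hG, degree_mul, degree_C haK, zero_add]
  have hlc : G.leadingCoeff ≠ 0 := leadingCoeff_ne_zero.mpr hG0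
  obtain ⟨c, U, V, hc, hUV⟩ : ∃ (c : A) (U V : A[X]), c ≠ 0 ∧
      U * G + V * derivative G = C c := by
    have hsep : IsCoprime (minpoly K τ) (derivative (minpoly K τ)) :=
      (minpoly.irreducible hint).separable
    obtain ⟨u, v, huv⟩ := hsep
    obtain ⟨a₁, U, ha₁, hU⟩ := exists_C_mul_eq_map (A := A) u
    obtain ⟨a₂, V, ha₂, hV⟩ := exists_C_mul_eq_map (A := A) v
    refine ⟨a * a₁ * a₂, C a₂ * U, C a₁ * V, mul_ne_zero (mul_ne_zero ha ha₁) ha₂, ?_⟩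
    apply Polynomial.map_injective _ hinj
    simp only [Polynomial.map_add, Polynomial.map_mul, ← derivative_map, hU, hV, hG, map_C,
      derivative_C_mul, map_mul]
    linear_combination (C (algebraMap A K a) * C (algebraMap A K a₁) *
      C (algebraMap A K a₂)) * huv
  have hker : ∀ Q : A[X], aeval θ Q = 0 →
      ∃ (k : ℕ) (R : A[X]), C (G.leadingCoeff ^ k) * Q = G * R := by
    intro Q hQ
    obtain ⟨k, R, S, h1, h2⟩ := exists_pseudo_division G hG0 Q
    have hS : aeval θ S = 0 := by
      have := congrArg (aeval θ) h1
      simpa [hQ, hGθ] using this.symm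
    -- The pseudo-remainder kills `τ` but has smaller degree than its minimal polynomial.
    have hS0 : S.map (algebraMap A K) = 0 := by
      by_contra hne
      have h3 : aeval τ (S.map (algebraMap A K)) = 0 := by rw [← haev, hS, map_zero]
      have := minpoly.degree_le_of_ne_zero K τ hne h3
      rw [degree_map_eq_of_injective hinj, ← hdeg] at this
      exact absurd h2 (not_lt.mpr this)
    have : S = 0 := Polynomial.map_injective _ hinj (by rw [hS0, Polynomial.map_zero])
    exact ⟨k, R, by rw [h1, this, add_zero]⟩
  have hgen : ∀ b : B, ∃ (r : A) (Q : A[X]), r ≠ 0 ∧ algebraMap A B r * b = aeval θ Q := by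
    intro b
    have hb : algebraMap B L b ∈ Algebra.adjoin K {τ} := by rw [hθ]; trivial
    rw [Algebra.adjoin_singleton_eq_range_aeval] at hb
    obtain ⟨q, hq⟩ := hb
    obtain ⟨r, Q, hr, hQ⟩ := exists_C_mul_eq_map (A := A) q
    refine ⟨r, Q, hr, hinjL ?_⟩
    have hq' : aeval τ q = algebraMap B L b := hq
    rw [haev, hQ, map_mul, map_mul, aeval_C, hq', ← IsScalarTower.algebraMap_apply,
      ← IsScalarTower.algebraMap_apply]
  obtain ⟨s, hs⟩ := (‹Algebra.FiniteType A B›).out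
  choose r Q hr hQ using hgen
  -- `h` collects the leading coefficient (for pseudo-division), the Bézout constant `c`, and the
  -- denominators `r b` of the generators.
  refine ⟨⟨G.leadingCoeff * c * ∏ b ∈ s, r b, θ, G,
    mul_ne_zero (mul_ne_zero hlc hc) (Finset.prod_ne_zero_iff.mpr fun b _ => hr b), hGθ,
    ⟨c * ∏ b ∈ s, r b, by ring⟩,
    ⟨C (G.leadingCoeff * ∏ b ∈ s, r b) * U, C (G.leadingCoeff * ∏ b ∈ s, r b) * V, ?_⟩, ?_, ?_⟩⟩
  · rw [mul_assoc, mul_assoc, ← mul_add, hUV, ← C_mul]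
    ring_nf
  · intro Q hQ
    obtain ⟨k, R, h⟩ := hker Q hQ
    refine ⟨k, C ((c * ∏ b ∈ s, r b) ^ k) * R, ?_⟩
    rw [mul_assoc, mul_pow, C_mul, mul_right_comm, h]
    ring
  · intro b
    have hb : b ∈ Algebra.adjoin A (s : Set B) := by rw [hs]; trivial
    induction hb using Algebra.adjoin_induction with
    | mem x hx =>
      refine ⟨1, C (G.leadingCoeff * c * ∏ b ∈ s.erase x, r b) * Q x, ?_⟩
      rw [map_mul, aeval_C, ← hQ x, ← mul_assoc, ← map_mul, pow_one,
        ← Finset.mul_prod_erase s r (Finset.mem_coe.mp hx)]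
      congr 2
      ring
    | algebraMap a => exact ⟨0, C a, by simp⟩
    | add x y _ _ hx hy =>
      obtain ⟨k, P, h⟩ := hx
      obtain ⟨k', P', h'⟩ := hy
      refine ⟨k + k', C ((G.leadingCoeff * c * ∏ b ∈ s, r b) ^ k') * P +
        C ((G.leadingCoeff * c * ∏ b ∈ s, r b) ^ k) * P', ?_⟩
      rw [map_add, map_mul, map_mul, ← h, ← h', pow_add, map_mul, aeval_C, aeval_C]
      ring
    | mul x y _ _ hx hy =>
      obtain ⟨k, P, h⟩ := hx
      obtain ⟨k', P', h'⟩ := hy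
      exact ⟨k + k', P * P', by rw [map_mul, ← h, ← h', pow_add, map_mul]; ring⟩

end Existence

end RealAlg

/-! ### Parity of the degree and number of real roots -/

namespace RealAlg

open Polynomial

/-- A real polynomial without real roots has even degree. -/
theorem even_natDegree_of_no_root (P : ℝ[X]) (hP : ∀ t : ℝ, P.eval t ≠ 0) :
    Even P.natDegree := by
  have hP0 : P ≠ 0 := by
    rintro rfl
    exact hP 0 (by simp)
  induction P using UniqueFactorizationMonoid.induction_on_prime with
  | h₁ => exact absurd rfl hP0
  | h₂ x hx => rw [natDegree_eq_zero_of_isUnit hx]; exact Even.zero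
  | h₃ a q ha hq ih =>
    have hq0 : q ≠ 0 := hq.ne_zero
    rw [natDegree_mul hq0 ha]
    refine Even.add ?_ (ih (fun t ht => hP t (by simp [ht])) ha)
    -- Irreducible real polynomials have degree at most 2, and degree 1 would give a root.
    have h2 := hq.irreducible.natDegree_le_two
    have h0 : 0 < q.natDegree := hq.irreducible.natDegree_pos
    have h1 : q.natDegree ≠ 1 := by
      intro h1
      obtain ⟨t, ht⟩ := exists_root_of_degree_eq_one (degree_eq_iff_natDegree_eq hq0 |>.mpr h1)
      exact hP t (by rw [eval_mul, ht.eq_zero, zero_mul])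
    have : q.natDegree = 2 := by omega
    rw [this]; exact even_two

/-- A separable real polynomial with exactly one real root has odd degree. -/
theorem odd_natDegree_of_unique_root {P : ℝ[X]} (hP : P.Separable) {r : ℝ} (hr : P.eval r = 0)
    (huniq : ∀ t, P.eval t = 0 → t = r) : Odd P.natDegree := by
  obtain ⟨Q, hQ⟩ := dvd_iff_isRoot.mpr (show P.IsRoot r from hr)
  -- A root of the cofactor would have to be `r` again, a double root of `P`.
  have hQr : ∀ t, Q.eval t ≠ 0 := by
    intro t ht
    have htr : t = r := huniq t (by rw [hQ, eval_mul, ht, mul_zero])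
    subst htr
    obtain ⟨u, v, huv⟩ := hP
    have := congrArg (eval t) huv
    rw [hQ] at this
    simp [ht] at this
  have hQ0 : Q ≠ 0 := by
    rintro rfl
    exact hQr 0 (by simp)
  rw [hQ, natDegree_mul (X_sub_C_ne_zero r) hQ0, natDegree_X_sub_C, add_comm]
  exact (even_natDegree_of_no_root Q hQr).add_one

/-! ### Krull dimension and transcendence degree -/

section KrullDim

variable {R S : Type*} [CommRing R] [CommRing S] [Algebra R S]

/-- Lying over starts the chain and going up extends it. Keeping track of the last prime is what the
induction needs. -/
theorem exists_ltSeries_over [Algebra.IsIntegral R S] [FaithfulSMul R S]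
    (l : LTSeries (PrimeSpectrum R)) :
    ∃ lS : LTSeries (PrimeSpectrum S), lS.length = l.length ∧
      PrimeSpectrum.comap (algebraMap R S) lS.last = l.last := by
  induction l using RelSeries.inductionOn' with
  | singleton x =>
    obtain ⟨Q, hQ, h⟩ := Ideal.exists_ideal_over_prime_of_isIntegral x.asIdeal (⊥ : Ideal S)
      (by
        rw [← RingHom.ker_eq_comap_bot,
          (RingHom.injective_iff_ker_eq_bot _).mp (FaithfulSMul.algebraMap_injective R S)]
        exact bot_le)
    exact ⟨RelSeries.singleton _ ⟨Q, h.1⟩, rfl, PrimeSpectrum.ext h.2⟩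
  | snoc p x hx ih =>
    obtain ⟨lS, hl, hlast⟩ := ih
    have hlt : p.last < x := hx
    obtain ⟨Q, hle, hQ, hcomap⟩ := Ideal.exists_ideal_over_prime_of_isIntegral x.asIdeal
      lS.last.asIdeal (by
        have := congrArg PrimeSpectrum.asIdeal hlast
        rw [PrimeSpectrum.comap_asIdeal] at this
        rw [this]
        exact hlt.le)
    refine ⟨lS.snoc ⟨Q, hQ⟩ ?_, congrArg (· + 1) hl, ?_⟩
    · refine lt_of_le_of_ne hle fun heq => hlt.ne ?_
      rw [← hlast]
      exact PrimeSpectrum.ext (by rw [PrimeSpectrum.comap_asIdeal, heq, hcomap])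
    · rw [RelSeries.last_snoc, RelSeries.last_snoc]
      exact PrimeSpectrum.ext hcomap

/-- The Krull dimension is invariant under injective integral extensions. -/
theorem ringKrullDim_eq_of_isIntegral [Algebra.IsIntegral R S] [FaithfulSMul R S] :
    ringKrullDim S = ringKrullDim R := by
  apply le_antisymm
  · refine Order.krullDim_le_of_strictMono (PrimeSpectrum.comap (algebraMap R S)) ?_
    intro I J hIJ
    exact Ideal.IsIntegral.comap_lt_comap (R := R) (I := I.asIdeal) (J := J.asIdeal) hIJ
  · refine iSup_le fun l => ?_
    obtain ⟨lS, hl, -⟩ := exists_ltSeries_over (S := S) l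
    rw [← hl]
    exact le_iSup (fun p : LTSeries (PrimeSpectrum S) => (p.length : WithBot ℕ∞)) lS

/-- The Krull dimension of a finitely generated domain over a field is its transcendence degree. -/
theorem ringKrullDim_eq_trdeg (k : Type*) (R : Type*) [Field k] [CommRing R] [IsDomain R]
    [Algebra k R] [Algebra.FiniteType k R] {d : ℕ} (hd : ringKrullDim R = d) :
    Algebra.trdeg k R = d := by
  -- By Noether normalization, both invariants equal the number `s` of variables.
  obtain ⟨s, g, hinj, hint⟩ := exists_integral_inj_algHom_of_fg k R
  let := g.toRingHom.toAlgebra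
  have : Algebra.IsIntegral (MvPolynomial (Fin s) k) R := ⟨hint⟩
  have : FaithfulSMul (MvPolynomial (Fin s) k) R :=
    (faithfulSMul_iff_algebraMap_injective _ _).mpr hinj
  have : IsScalarTower k (MvPolynomial (Fin s) k) R :=
    IsScalarTower.of_algebraMap_eq fun x => (g.commutes x).symm
  have h1 := ringKrullDim_eq_of_isIntegral (R := MvPolynomial (Fin s) k) (S := R)
  rw [hd, MvPolynomial.ringKrullDim_of_isNoetherianRing, ringKrullDim_eq_zero_of_field,
    zero_add, Nat.card_fin] at h1
  have hds : d = s := by exact_mod_cast h1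
  have h2 := lift_trdeg_add_eq k (MvPolynomial (Fin s) k) R
  rw [trdeg_eq_zero (R := MvPolynomial (Fin s) k) (A := R),
    MvPolynomial.trdeg_of_isDomain] at h2
  simp only [Cardinal.mk_fin, Cardinal.lift_natCast, Cardinal.lift_zero, add_zero] at h2
  rw [hds]
  exact Cardinal.lift_eq_nat_iff.mp h2.symm

end KrullDim

end RealAlg

/-! ### Coordinate rings and their real points -/

namespace RealAlg

open MvPolynomial Topology

variable {n : ℕ}

/-- The ring of polynomial functions on a subset of `ℝⁿ`. -/
abbrev CoordRing (V : Set (Fin n → ℝ)) : Type :=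
  MvPolynomial (Fin n) ℝ ⧸ vanishingIdeal ℝ V

/-- Evaluation of polynomial functions at a point. -/
noncomputable def evalAt {V : Set (Fin n → ℝ)} {z : Fin n → ℝ} (hz : z ∈ V) : CoordRing V →+* ℝ :=
  Ideal.Quotient.lift _ (eval z) fun P hP => by
    simpa [aeval_eq_eval] using (mem_vanishingIdeal_iff.mp hP) z hz

@[simp]
theorem evalAt_mk {V : Set (Fin n → ℝ)} {z : Fin n → ℝ} (hz : z ∈ V)
    (P : MvPolynomial (Fin n) ℝ) :
    evalAt hz (Ideal.Quotient.mk (vanishingIdeal ℝ V) P) = eval z P :=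
  Ideal.Quotient.lift_mk _ _ _

/-- A polynomial function is nonzero at some point of every set with the same vanishing ideal. -/
theorem exists_evalAt_ne_zero {V W : Set (Fin n → ℝ)} (hWV : W ⊆ V)
    (h : vanishingIdeal ℝ W = vanishingIdeal ℝ V) {a : CoordRing V} (ha : a ≠ 0) :
    ∃ (z : Fin n → ℝ) (hz : z ∈ W), evalAt (hWV hz) a ≠ 0 := by
  obtain ⟨P, rfl⟩ := Ideal.Quotient.mk_surjective a
  by_contra! hcon
  refine ha (Ideal.Quotient.eq_zero_iff_mem.mpr ?_)
  rw [← h]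
  intro z hz
  simpa [aeval_eq_eval] using hcon z hz

/-- A ring homomorphism from a polynomial ring over `ℝ` to `ℝ` is evaluation at a point. -/
theorem ringHom_eq_eval (β : MvPolynomial (Fin n) ℝ →+* ℝ) : β = eval fun i => β (X i) := by
  refine MvPolynomial.ringHom_ext (fun r => ?_) (fun i => by simp)
  -- The only ring endomorphism of `ℝ` is the identity, so real points need not be assumed
  -- `ℝ`-linear.
  have : β.comp C = RingHom.id ℝ := Subsingleton.elim _ _
  rw [eval_C]
  exact RingHom.congr_fun this r

theorem ringHom_mk_eq_eval {V : Set (Fin n → ℝ)} (β : CoordRing V →+* ℝ)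
    (P : MvPolynomial (Fin n) ℝ) :
    β (Ideal.Quotient.mk _ P) = eval (fun i => β (Ideal.Quotient.mk _ (X i))) P :=
  RingHom.congr_fun (ringHom_eq_eval (β.comp (Ideal.Quotient.mk _))) P

/-- A real point of the coordinate ring of an algebraic set is a point of this set. -/
theorem point_mem {V : Set (Fin n → ℝ)} (hV : IsAlgebraicSet V) (β : CoordRing V →+* ℝ) :
    (fun i => β (Ideal.Quotient.mk _ (X i))) ∈ V := by
  obtain ⟨I, hI⟩ := hV
  suffices h : (fun i => β (Ideal.Quotient.mk _ (X i))) ∈ zeroLocus ℝ I by rwa [← hI] at h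
  intro P hP
  have : P ∈ vanishingIdeal ℝ V := by
    rw [hI]
    exact le_vanishingIdeal_zeroLocus I hP
  rw [aeval_eq_eval, ← ringHom_mk_eq_eval, Ideal.Quotient.eq_zero_iff_mem.mpr this,
    map_zero]

theorem IsAlgebraicSet.inter_zeros {V : Set (Fin n → ℝ)} (hV : IsAlgebraicSet V)
    (P : MvPolynomial (Fin n) ℝ) : IsAlgebraicSet (V ∩ {x | eval x P = 0}) := by
  obtain ⟨I, rfl⟩ := hV
  refine ⟨I ⊔ Ideal.span {P}, ?_⟩
  ext x
  constructor
  · rintro ⟨h1, h2⟩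
    have hle : I ⊔ Ideal.span {P} ≤ vanishingIdeal ℝ {x} := by
      refine sup_le (fun Q hQ => ?_) ((Ideal.span_singleton_le_iff_mem _).mpr ?_)
      · rw [mem_vanishingIdeal_singleton_iff]; exact h1 Q hQ
      · rw [mem_vanishingIdeal_singleton_iff]; exact h2
    exact fun Q hQ => (mem_vanishingIdeal_singleton_iff _ _).mp (hle hQ)
  · intro h
    exact ⟨fun Q hQ => h Q (Ideal.mem_sup_left hQ),
      h P (Ideal.mem_sup_right (Ideal.mem_span_singleton_self P))⟩

theorem IsIrreducibleAlgebraicSet.isPrime {V : Set (Fin n → ℝ)}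
    (hV : IsIrreducibleAlgebraicSet V) : (vanishingIdeal ℝ V).IsPrime := by
  refine ⟨?_, ?_⟩
  · obtain ⟨z, hz⟩ := hV.nonempty
    rw [Ideal.ne_top_iff_one]
    intro h
    simpa using h z hz
  · intro P Q hPQ
    have hun : V = (V ∩ {x | eval x P = 0}) ∪ (V ∩ {x | eval x Q = 0}) := by
      rw [← Set.inter_union_distrib_left, eq_comm, Set.inter_eq_left]
      intro z hz
      have := hPQ z hz
      rw [map_mul, mul_eq_zero] at this
      exact this
    rcases hV.eq_or_eq_of_union _ _ (hV.isAlgebraic.inter_zeros P)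
      (hV.isAlgebraic.inter_zeros Q) hun with h | h
    · left
      intro z hz
      rw [h] at hz
      exact hz.2
    · right
      intro z hz
      rw [h] at hz
      exact hz.2

/-! ### Continuous local sections and a Zariski dense component -/

theorem contDiff_eval {s : ℕ} (P : MvPolynomial (Fin s) ℝ) :
    ContDiff ℝ 1 (fun x : Fin s → ℝ => eval x P) := by
  induction P using MvPolynomial.induction_on with
  | C a => simpa using contDiff_const
  | add p q hp hq => simpa using hp.add hq
  | mul_X p i hp => simpa using hp.mul (contDiff_apply ℝ ℝ i)

theorem contDiff_eval₂ {s : ℕ} (Q : Polynomial (MvPolynomial (Fin s) ℝ)) :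
    ContDiff ℝ 1 (fun u : (Fin s → ℝ) × ℝ => Q.eval₂ (eval u.1) u.2) := by
  induction Q using Polynomial.induction_on' with
  | add p q hp hq => simpa using hp.add hq
  | monomial k a =>
    simpa using ((contDiff_eval a).comp contDiff_fst).mul (contDiff_snd.pow k)

/-- Simple real roots of a polynomial depend continuously on parameters. -/
theorem exists_continuous_root {s : ℕ} (G : Polynomial (MvPolynomial (Fin s) ℝ)) (x₀ : Fin s → ℝ)
    (t₀ : ℝ) (h₀ : G.eval₂ (eval x₀) t₀ = 0)
    (h₁ : (G.map (eval x₀)).derivative.eval t₀ ≠ 0) :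
    ∃ ψ : (Fin s → ℝ) → ℝ, ∀ᶠ x in 𝓝 x₀, G.eval₂ (eval x) (ψ x) = 0 ∧ ContinuousAt ψ x := by
  set f : (Fin s → ℝ) × ℝ → ℝ := fun u => G.eval₂ (eval u.1) u.2 with hf
  have hcd : ContDiffAt ℝ 1 f (x₀, t₀) := (contDiff_eval₂ G).contDiffAt
  have hd : HasDerivAt (fun t => f (x₀, t)) ((G.map (eval x₀)).derivative.eval t₀) t₀ := by
    simpa only [hf, Polynomial.eval_map] using (G.map (eval x₀)).hasDerivAt t₀
  have hd' : HasFDerivAt (fun t => f (x₀, t))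
      (fderiv ℝ f (x₀, t₀) ∘L .inr ℝ (Fin s → ℝ) ℝ) t₀ :=
    (hcd.differentiableAt one_ne_zero).hasFDerivAt.comp t₀ (hasFDerivAt_prodMk_right x₀ t₀)
  -- The partial derivative in `t` is multiplication by a nonzero real number, as `t₀` is a simple
  -- root.
  have hinv : (fderiv ℝ f (x₀, t₀) ∘L .inr ℝ (Fin s → ℝ) ℝ).IsInvertible := by
    rw [hd'.unique hd.hasFDerivAt]
    refine ⟨ContinuousLinearEquiv.unitsEquivAut ℝ (Units.mk0 _ h₁), ?_⟩
    ext
    simp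
  refine ⟨hcd.implicitFunction one_ne_zero hinv, ?_⟩
  have e1 := hcd.eventually_apply_implicitFunction one_ne_zero hinv
  have e2 := (hcd.contDiffAt_implicitFunction one_ne_zero hinv).eventually (by simp)
  filter_upwards [e1, e2] with x hx1 hx2
  exact ⟨hx1.trans h₀, hx2.continuousAt⟩

/-- An irreducible real algebraic set has a Zariski dense connected component. -/
theorem exists_component_vanishingIdeal_eq {Z : Set (Fin n → ℝ)}
    (hZ : IsIrreducibleAlgebraicSet Z) :
    ∃ C, IsConnectedComponentOf C Z ∧ vanishingIdeal ℝ C = vanishingIdeal ℝ Z := by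
  have := hZ.isPrime
  have : Algebra.FiniteType ℝ (CoordRing Z) := inferInstance
  obtain ⟨s, g, hinj, hint⟩ := exists_integral_inj_algHom_of_fg ℝ (CoordRing Z)
  let := g.toRingHom.toAlgebra
  have : Algebra.IsIntegral (MvPolynomial (Fin s) ℝ) (CoordRing Z) := ⟨hint⟩
  have : FaithfulSMul (MvPolynomial (Fin s) ℝ) (CoordRing Z) :=
    (faithfulSMul_iff_algebraMap_injective _ _).mpr hinj
  have : IsScalarTower ℝ (MvPolynomial (Fin s) ℝ) (CoordRing Z) :=
    IsScalarTower.of_algebraMap_eq fun x => (g.commutes x).symm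
  have : Algebra.FiniteType (MvPolynomial (Fin s) ℝ) (CoordRing Z) :=
    Algebra.FiniteType.of_restrictScalars_finiteType ℝ _ _
  obtain ⟨D⟩ := exists_genericPrimitive (MvPolynomial (Fin s) ℝ) (CoordRing Z)
  have hh : algebraMap _ (CoordRing Z) D.h ≠ 0 := by
    simpa using D.h_ne_zero
  obtain ⟨z, hz, hzh⟩ := exists_evalAt_ne_zero (subset_refl Z) rfl hh
  set β := evalAt (V := Z) hz
  set x₀ : Fin s → ℝ := fun i =>
    β (algebraMap (MvPolynomial (Fin s) ℝ) (CoordRing Z) (X i))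
  have hβ : β.comp (algebraMap (MvPolynomial (Fin s) ℝ) (CoordRing Z)) = eval x₀ :=
    ringHom_eq_eval _
  have hζ : eval x₀ D.h ≠ 0 := by rwa [← hβ]
  have hroot : D.G.eval₂ (eval x₀) (β D.θ) = 0 := by
    rw [← hβ]
    exact D.eval₂_G_eq_zero β
  have hder : (D.G.map (eval x₀)).derivative.eval (β D.θ) ≠ 0 := by
    refine (D.separable_map _ hζ).eval₂_derivative_ne_zero (RingHom.id ℝ) ?_
    rwa [Polynomial.eval₂_id, Polynomial.eval_map]
  obtain ⟨ψ, hψ⟩ := exists_continuous_root D.G x₀ _ hroot hder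
  have hev : ∀ᶠ x in 𝓝 x₀, eval x D.h ≠ 0 :=
    (contDiff_eval D.h).continuous.continuousAt.eventually_ne hζ
  obtain ⟨ε, hε, hU⟩ := Metric.eventually_nhds_iff_ball.mp (hψ.and hev)
  -- The section: the point over `x` at which the primitive element takes the value `ψ x`. It is
  -- meaningful only on the ball, where `h` does not vanish and `ψ x` is a root.
  set σ : (Fin s → ℝ) → (Fin n → ℝ) := fun x i =>
    D.pointValue (eval x) (ψ x) (Ideal.Quotient.mk _ (X i))
  have hpt : ∀ x ∈ Metric.ball x₀ ε, ∃ γ : CoordRing Z →+* ℝ,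
      (∀ a, γ (algebraMap _ _ a) = eval x a) ∧ ∀ i, γ (Ideal.Quotient.mk _ (X i)) = σ x i := by
    intro x hx
    obtain ⟨⟨h1, -⟩, h2⟩ := hU x hx
    exact ⟨D.point (eval x) h2 h1, D.point_algebraMap _ h2 h1, fun i => rfl⟩
  have hσZ : ∀ x ∈ Metric.ball x₀ ε, σ x ∈ Z := by
    intro x hx
    obtain ⟨γ, -, hγ⟩ := hpt x hx
    have := point_mem hZ.isAlgebraic γ
    rwa [funext hγ] at this
  have hcont : ContinuousOn σ (Metric.ball x₀ ε) := by
    rw [continuousOn_pi]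
    intro i
    obtain ⟨k, Q, hQ⟩ := D.exists_aeval_eq (Ideal.Quotient.mk _ (X i))
    have heq : ∀ x ∈ Metric.ball x₀ ε,
        σ x i = Q.eval₂ (eval x) (ψ x) / eval x D.h ^ k := fun x hx =>
      D.pointValue_eq (eval x) (hU x hx).2 (hU x hx).1.1 hQ
    refine ContinuousOn.congr ?_ heq
    intro x hx
    refine ContinuousAt.continuousWithinAt (ContinuousAt.div ?_ ?_ (pow_ne_zero _ (hU x hx).2))
    · exact (contDiff_eval₂ Q).continuous.continuousAt.comp
        (f := fun x => (x, ψ x)) (continuousAt_id.prodMk (hU x hx).1.2)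
    · exact (contDiff_eval D.h).continuous.continuousAt.pow k
  have hx₀ : x₀ ∈ Metric.ball x₀ ε := Metric.mem_ball_self hε
  refine ⟨connectedComponentIn Z (σ x₀), ⟨σ x₀, hσZ x₀ hx₀, rfl⟩, le_antisymm ?_
    (vanishingIdeal_anti_mono (connectedComponentIn_subset _ _))⟩
  have hsub : σ '' Metric.ball x₀ ε ⊆ connectedComponentIn Z (σ x₀) :=
    ((convex_ball x₀ ε).isPreconnected.image σ hcont).subset_connectedComponentIn
      (Set.mem_image_of_mem σ hx₀) (Set.image_subset_iff.mpr hσZ)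
  intro P hP
  by_contra hPZ
  have hP0 : (Ideal.Quotient.mk (vanishingIdeal ℝ Z) P) ≠ 0 :=
    fun h => hPZ (Ideal.Quotient.eq_zero_iff_mem.mp h)
  have halg : IsAlgebraic (MvPolynomial (Fin s) ℝ) (Ideal.Quotient.mk (vanishingIdeal ℝ Z) P) :=
    Algebra.IsAlgebraic.isAlgebraic _
  -- `P` divides a nonzero polynomial `r` in the base variables. As `P` vanishes on the image of
  -- `σ`, `r` vanishes on the ball, which is a product of intervals for the sup metric; so `r = 0`.
  obtain ⟨r, hr, c, hc⟩ := halg.exists_nonzero_dvd (mem_nonZeroDivisors_of_ne_zero hP0)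
  refine hr (MvPolynomial.funext_set (fun i => Metric.ball (x₀ i) ε) (fun i => ?_) fun x hx => ?_)
  · rw [Real.ball_eq_Ioo]
    exact Set.Ioo_infinite (by linarith)
  · have hx' : x ∈ Metric.ball x₀ ε := by rwa [ball_pi x₀ hε]
    obtain ⟨γ, hγ1, hγ2⟩ := hpt x hx'
    have h0 : eval (σ x) P = 0 := hP _ (hsub (Set.mem_image_of_mem σ hx'))
    rw [map_zero, ← hγ1, hc, map_mul, ringHom_mk_eq_eval, funext hγ2, h0, zero_mul]

end RealAlg

/-! ### Lifting real points by parity; dimension and density -/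

namespace RealAlg

open MvPolynomial

/-- For a generically finite extension of domains, if some generic real point has exactly one real
preimage, then every generic real point has a real preimage. -/
theorem exists_real_point_over (A B : Type*) [CommRing A] [IsDomain A] [CommRing B] [IsDomain B]
    [Algebra A B] [FaithfulSMul A B] [Algebra.IsAlgebraic A B] [Algebra.FiniteType A B]
    [CharZero A] :
    ∃ h : A, h ≠ 0 ∧ ∀ ζ ζ' : A →+* ℝ, ζ h ≠ 0 → ζ' h ≠ 0 →
      (∃! β : B →+* ℝ, β.comp (algebraMap A B) = ζ) →
      ∃ β : B →+* ℝ, β.comp (algebraMap A B) = ζ' := by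
  obtain ⟨D⟩ := exists_genericPrimitive A B
  refine ⟨D.h, D.h_ne_zero, ?_⟩
  rintro ζ ζ' hζ hζ' ⟨β, hβ, huniq⟩
  have hodd : Odd (D.G.map ζ).natDegree := by
    refine odd_natDegree_of_unique_root (D.separable_map ζ hζ) (r := β D.θ) ?_ ?_
    · rw [Polynomial.eval_map, ← hβ]
      exact D.eval₂_G_eq_zero β
    -- Each real root defines a point of `B` over `ζ`, so uniqueness of the point gives uniqueness
    -- of the root.
    · intro t ht
      rw [Polynomial.eval_map] at ht
      rw [← huniq (D.point ζ hζ ht) (RingHom.ext (D.point_algebraMap ζ hζ ht)), D.point_θ]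
  rw [D.natDegree_map ζ hζ, ← D.natDegree_map ζ' hζ'] at hodd
  obtain ⟨t, ht⟩ : ∃ t, (D.G.map ζ').eval t = 0 := by
    by_contra! hno
    exact Nat.not_even_iff_odd.mpr hodd (even_natDegree_of_no_root _ hno)
  rw [Polynomial.eval_map] at ht
  exact ⟨D.point ζ' hζ' ht, RingHom.ext (D.point_algebraMap ζ' hζ' ht)⟩

/-- Transcendence degrees add in towers, and the finite cardinal `d` can be cancelled. -/
theorem isAlgebraic_of_trdeg_eq.{u, v} {k : Type u} {A B : Type v} [Field k] [CommRing A]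
    [IsDomain A] [CommRing B] [IsDomain B] [Algebra k A] [Algebra k B] [Algebra A B]
    [IsScalarTower k A B] [FaithfulSMul A B] {d : ℕ} (hA : Algebra.trdeg k A = d)
    (hB : Algebra.trdeg k B = d) :
    Algebra.IsAlgebraic A B := by
  rw [← trdeg_eq_zero_iff]
  have h := trdeg_add_eq k A (A := B)
  rw [hA, hB] at h
  exact Cardinal.eq_of_add_eq_add_left (by rw [h, add_zero]) Cardinal.natCast_lt_aleph0

theorem trdeg_eq_of_isAlgebraic.{u, v} (k : Type u) (A B : Type v) [Field k] [CommRing A]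
    [IsDomain A] [CommRing B] [IsDomain B] [Algebra k A] [Algebra k B] [Algebra A B]
    [IsScalarTower k A B] [FaithfulSMul A B] [Algebra.IsAlgebraic A B] :
    Algebra.trdeg k B = Algebra.trdeg k A := by
  rw [← trdeg_add_eq k A (A := B), trdeg_eq_zero (R := A), add_zero]

theorem dim_le_of_subset {n : ℕ} {W V : Set (Fin n → ℝ)} (h : W ⊆ V) : dim W ≤ dim V :=
  ringKrullDim_le_of_surjective _ (Ideal.Quotient.factor_surjective (vanishingIdeal_anti_mono h))

/-- A subset of full dimension of an irreducible algebraic set is Zariski dense in it. -/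
theorem vanishingIdeal_eq_of_dim_eq {n d : ℕ} {W V : Set (Fin n → ℝ)}
    (hV : IsIrreducibleAlgebraicSet V) (h : W ⊆ V) (hWd : dim W = d) (hVd : dim V = d) :
    vanishingIdeal ℝ W = vanishingIdeal ℝ V := by
  have := hV.isPrime
  refine le_antisymm (fun P hP => ?_) (vanishingIdeal_anti_mono h)
  by_contra hPV
  have hle : vanishingIdeal ℝ V ≤ vanishingIdeal ℝ W := vanishingIdeal_anti_mono h
  have hne : Ideal.Quotient.mk (vanishingIdeal ℝ V) P ≠ 0 :=
    fun h => hPV (Ideal.Quotient.eq_zero_iff_mem.mp h)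
  -- `P` is a nonzerodivisor on the coordinate ring of `V` and dies on `W`, which costs at least one
  -- dimension.
  have key := ringKrullDim_succ_le_of_surjective _ (Ideal.Quotient.factor_surjective hle)
    (mem_nonZeroDivisors_of_ne_zero hne)
    (by rw [Ideal.Quotient.factor_mk]; exact Ideal.Quotient.eq_zero_iff_mem.mpr hP)
  change dim W + 1 ≤ dim V at key
  rw [hWd, hVd] at key
  have : d + 1 ≤ d := by exact_mod_cast key
  omega

/-! ### Rational functions in lowest terms -/

section RationalFunction

variable {p : ℕ}

/-- The numerator of a rational function in lowest terms. -/
noncomputable abbrev ratNum (f : RationalFunction p) : MvPolynomial (Fin p) ℝ :=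
  IsFractionRing.num (MvPolynomial (Fin p) ℝ) f

/-- The denominator of a rational function in lowest terms. -/
noncomputable abbrev ratDen (f : RationalFunction p) : MvPolynomial (Fin p) ℝ :=
  IsFractionRing.den (MvPolynomial (Fin p) ℝ) f

theorem isRepresentationAt_num_den {f : RationalFunction p} {x : Fin p → ℝ}
    (h : eval x (ratDen f) ≠ 0) : IsRepresentationAt f x (ratNum f, ratDen f) :=
  ⟨h, (IsFractionRing.mk'_num_den' _ f).symm⟩

/-- A rational function is defined exactly where its reduced denominator does not vanish. -/
theorem isDefinedAt_iff {f : RationalFunction p} {x : Fin p → ℝ} :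
    IsDefinedAt f x ↔ eval x (ratDen f) ≠ 0 := by
  refine ⟨?_, fun h => ⟨_, isRepresentationAt_num_den h⟩⟩
  rintro ⟨⟨a, b⟩, hb, hf⟩ h0
  have inj := IsFractionRing.injective (MvPolynomial (Fin p) ℝ) (RationalFunction p)
  have hb0 : algebraMap _ (RationalFunction p) b ≠ 0 := by
    rw [map_ne_zero_iff _ inj]
    rintro rfl
    exact hb (map_zero _)
  have hd0 : algebraMap _ (RationalFunction p) (ratDen f) ≠ 0 := by
    rw [map_ne_zero_iff _ inj]
    exact nonZeroDivisors.ne_zero (IsFractionRing.den _ f).2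
  have heq : algebraMap _ (RationalFunction p) (ratNum f) / algebraMap _ _ (ratDen f) =
      algebraMap _ (RationalFunction p) a / algebraMap _ _ b :=
    (IsFractionRing.mk'_num_den' _ f).trans hf
  rw [div_eq_div_iff hd0 hb0, ← map_mul, ← map_mul] at heq
  have hdvd : ratDen f ∣ ratNum f * b := ⟨a, by rw [inj heq, mul_comm]⟩
  -- The reduced denominator is coprime to the numerator, hence divides every other denominator `b`.
  obtain ⟨c, hc⟩ := (IsFractionRing.num_den_reduced _ f).symm.dvd_of_dvd_mul_left hdvd
  apply hb
  change eval x b = 0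
  rw [hc, map_mul, h0, zero_mul]

end RationalFunction

/-! ### Regular functions on the domain, and the comorphism -/

section Comorphism

variable {m p : ℕ}

/-- The product of the reduced denominators of a rational map. -/
noncomputable def commonDen (φ : RationalMap p m) : MvPolynomial (Fin p) ℝ := ∏ i, ratDen (φ i)

/-- The domain is a principal open set; this is why localizing at one element suffices. -/
theorem mem_domain_iff {φ : RationalMap p m} {x : Fin p → ℝ} :
    x ∈ φ.domain ↔ eval x (commonDen φ) ≠ 0 := by
  rw [commonDen, map_prod, Finset.prod_ne_zero_iff]
  simp [RationalMap.domain, isDefinedAt_iff]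

variable (Y : Set (Fin p → ℝ)) (φ : RationalMap p m)

/-- The ring of regular functions on the part of `Y` where the rational map is defined. -/
abbrev DomainRing : Type :=
  Localization.Away (Ideal.Quotient.mk (vanishingIdeal ℝ Y) (commonDen φ))

variable {Y φ}

/-- Evaluation at a point of `Y` in the domain of the rational map. -/
noncomputable def domainEval {y : Fin p → ℝ} (hy : y ∈ Y ∩ φ.domain) : DomainRing Y φ →+* ℝ :=
  IsLocalization.Away.lift (Ideal.Quotient.mk (vanishingIdeal ℝ Y) (commonDen φ))
    (g := evalAt hy.1) (by rw [evalAt_mk]; exact (mem_domain_iff.mp hy.2).isUnit)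

@[simp]
theorem domainEval_algebraMap {y : Fin p → ℝ} (hy : y ∈ Y ∩ φ.domain) (c : CoordRing Y) :
    domainEval hy (algebraMap _ (DomainRing Y φ) c) = evalAt hy.1 c :=
  IsLocalization.Away.lift_eq _ _ c

/-- The point of `ℝᵖ` given by a real point of the ring of regular functions. -/
noncomputable def toPoint (γ : DomainRing Y φ →+* ℝ) : Fin p → ℝ :=
  fun i => γ (algebraMap _ _ (Ideal.Quotient.mk (vanishingIdeal ℝ Y) (X i)))

theorem apply_algebraMap_mk (γ : DomainRing Y φ →+* ℝ) (P : MvPolynomial (Fin p) ℝ) :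
    γ (algebraMap _ _ (Ideal.Quotient.mk (vanishingIdeal ℝ Y) P)) = eval (toPoint γ) P :=
  ringHom_mk_eq_eval (γ.comp (algebraMap (CoordRing Y) (DomainRing Y φ))) P

theorem toPoint_domainEval {y : Fin p → ℝ} (hy : y ∈ Y ∩ φ.domain) :
    toPoint (domainEval hy) = y := by
  ext i
  simp [toPoint]

/-- Together with `toPoint_mem` and `toPoint_domainEval`, this identifies the real points of
`DomainRing Y φ` with `Y ∩ φ.domain`. -/
theorem toPoint_injective : Function.Injective (toPoint (Y := Y) (φ := φ)) := by
  intro γ γ' h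
  refine IsLocalization.ringHom_ext (Submonoid.powers
    (Ideal.Quotient.mk (vanishingIdeal ℝ Y) (commonDen φ))) (Ideal.Quotient.ringHom_ext ?_)
  refine RingHom.ext fun P => ?_
  change γ (algebraMap _ _ (Ideal.Quotient.mk _ P)) = γ' (algebraMap _ _ (Ideal.Quotient.mk _ P))
  rw [apply_algebraMap_mk, apply_algebraMap_mk, h]

theorem toPoint_mem (hY : IsAlgebraicSet Y) (γ : DomainRing Y φ →+* ℝ) :
    toPoint γ ∈ Y ∩ φ.domain := by
  refine ⟨point_mem hY (γ.comp (algebraMap (CoordRing Y) (DomainRing Y φ))), mem_domain_iff.mpr ?_⟩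
  rw [← apply_algebraMap_mk]
  exact ((IsLocalization.Away.algebraMap_isUnit
    (Ideal.Quotient.mk (vanishingIdeal ℝ Y) (commonDen φ))).map γ).ne_zero

/-- A regular function vanishing at all points is zero. -/
theorem eq_zero_of_domainEval {b : DomainRing Y φ}
    (h : ∀ (y : Fin p → ℝ) (hy : y ∈ Y ∩ φ.domain), domainEval hy b = 0) : b = 0 := by
  set g := Ideal.Quotient.mk (vanishingIdeal ℝ Y) (commonDen φ) with hg
  obtain ⟨k, c, hc⟩ := IsLocalization.Away.surj g b
  have hgu : IsUnit (algebraMap _ (DomainRing Y φ) g) := IsLocalization.Away.algebraMap_isUnit g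
  -- On the domain `c` vanishes because `b` does; off the domain `g` vanishes.
  have hcg : c * g = 0 := by
    obtain ⟨P, rfl⟩ := Ideal.Quotient.mk_surjective c
    rw [hg, ← map_mul, Ideal.Quotient.eq_zero_iff_mem]
    intro y hy
    by_cases hyd : y ∈ φ.domain
    · have hy' : y ∈ Y ∩ φ.domain := ⟨hy, hyd⟩
      have := congrArg (domainEval hy') hc
      rw [map_mul, h y hy', zero_mul, domainEval_algebraMap, evalAt_mk] at this
      rw [map_mul, aeval_eq_eval, ← this, zero_mul]
    · rw [mem_domain_iff, not_not] at hyd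
      rw [map_mul, aeval_eq_eval, hyd, mul_zero]
  have hc0 : algebraMap _ (DomainRing Y φ) c = 0 := by
    rw [← hgu.mul_left_eq_zero, ← map_mul, hcg, map_zero]
  rw [hc0] at hc
  exact (hgu.pow k).mul_left_eq_zero.mp hc

theorem exists_mul_den_eq_num (i : Fin m) : ∃ q : DomainRing Y φ,
    q * algebraMap _ _ (Ideal.Quotient.mk (vanishingIdeal ℝ Y) (ratDen (φ i))) =
      algebraMap _ _ (Ideal.Quotient.mk (vanishingIdeal ℝ Y) (ratNum (φ i))) := by
  have hu : IsUnit (algebraMap _ (DomainRing Y φ)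
      (Ideal.Quotient.mk (vanishingIdeal ℝ Y) (ratDen (φ i)))) := by
    have hdvd : ratDen (φ i) ∣ commonDen φ :=
      Finset.dvd_prod_of_mem (fun i => ratDen (φ i)) (Finset.mem_univ i)
    exact isUnit_of_dvd_unit (map_dvd _ (map_dvd _ hdvd))
      (IsLocalization.Away.algebraMap_isUnit
        (Ideal.Quotient.mk (vanishingIdeal ℝ Y) (commonDen φ)))
  obtain ⟨u, hu⟩ := hu
  refine ⟨algebraMap _ _ (Ideal.Quotient.mk (vanishingIdeal ℝ Y) (ratNum (φ i))) * ↑u⁻¹, ?_⟩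
  rw [← hu, mul_assoc, Units.inv_mul, mul_one]

variable (Y φ) in
/-- Composition of polynomial functions with a rational map. -/
noncomputable def pullback : MvPolynomial (Fin m) ℝ →ₐ[ℝ] DomainRing Y φ :=
  aeval fun i => (exists_mul_den_eq_num (Y := Y) (φ := φ) i).choose

/-- The bridge from algebra to geometry: composing real points with the comorphism is applying `φ`.
-/
theorem apply_pullback (hY : IsAlgebraicSet Y) (γ : DomainRing Y φ →+* ℝ)
    (P : MvPolynomial (Fin m) ℝ) : γ (pullback Y φ P) = eval (φ.toFun (toPoint γ)) P := by
  have h := RingHom.congr_fun (ringHom_eq_eval (γ.comp (pullback Y φ).toRingHom)) P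
  refine h.trans ?_
  congr 2
  ext i
  have hq := congrArg γ (exists_mul_den_eq_num (Y := Y) (φ := φ) i).choose_spec
  rw [map_mul, apply_algebraMap_mk, apply_algebraMap_mk] at hq
  have hne : eval (toPoint γ) (ratDen (φ i)) ≠ 0 :=
    isDefinedAt_iff.mp ((toPoint_mem hY γ).2 i)
  change γ (pullback Y φ (X i)) = value (φ i) (toPoint γ)
  rw [value_eq (isRepresentationAt_num_den hne), eq_div_iff hne, pullback, aeval_X]
  exact hq

/-- The pullback vanishes exactly on the polynomials vanishing on the image. -/
theorem pullback_eq_zero_iff (hY : IsAlgebraicSet Y) {M : Set (Fin m → ℝ)}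
    (hφ : Set.BijOn φ.toFun (Y ∩ φ.domain) M) (P : MvPolynomial (Fin m) ℝ) :
    pullback Y φ P = 0 ↔ P ∈ vanishingIdeal ℝ M := by
  constructor
  · intro h z hz
    obtain ⟨y, hy, rfl⟩ := hφ.surjOn hz
    have := apply_pullback hY (domainEval hy) P
    rw [h, map_zero, toPoint_domainEval] at this
    exact this.symm
  · intro h
    refine eq_zero_of_domainEval fun y hy => ?_
    rw [apply_pullback hY, toPoint_domainEval]
    exact h _ (hφ.mapsTo hy)

theorem isDomain_domainRing (hY : IsIrreducibleAlgebraicSet Y) (hne : (Y ∩ φ.domain).Nonempty) :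
    IsDomain (DomainRing Y φ) ∧ FaithfulSMul (CoordRing Y) (DomainRing Y φ) := by
  have := hY.isPrime
  obtain ⟨y, hy, hyd⟩ := hne
  have hg : Ideal.Quotient.mk (vanishingIdeal ℝ Y) (commonDen φ) ≠ 0 := by
    intro h
    have := congrArg (evalAt hy) h
    rw [evalAt_mk, map_zero] at this
    exact mem_domain_iff.mp hyd this
  have hle := powers_le_nonZeroDivisors_of_noZeroDivisors hg
  exact ⟨IsLocalization.isDomain_localization hle,
    (faithfulSMul_iff_algebraMap_injective _ _).mpr (IsLocalization.injective _ hle)⟩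

end Comorphism

/-! ### Dense subsets meet the image, and conclusion -/

/-- If `N` and `M` are Zariski dense in `Z` and `M` is in bijection with `Y ∩ dom φ` for an
irreducible algebraic set `Y` of the same dimension, then `N` meets `M`. -/
theorem inter_nonempty_of_bijOn {m p d : ℕ} {Z M N : Set (Fin m → ℝ)} {Y : Set (Fin p → ℝ)}
    {φ : RationalMap p m} (hZ : IsIrreducibleAlgebraicSet Z) (hZd : dim Z = d)
    (hMZ : M ⊆ Z) (hM : vanishingIdeal ℝ M = vanishingIdeal ℝ Z)
    (hNZ : N ⊆ Z) (hN : vanishingIdeal ℝ N = vanishingIdeal ℝ Z)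
    (hY : IsIrreducibleAlgebraicSet Y) (hYd : dim Y = d)
    (hφ : Set.BijOn φ.toFun (Y ∩ φ.domain) M) : (N ∩ M).Nonempty := by
  have := hZ.isPrime
  have := hY.isPrime
  have hYne : (Y ∩ φ.domain).Nonempty := by
    obtain ⟨z, hz, -⟩ := exists_evalAt_ne_zero hMZ hM one_ne_zero
    obtain ⟨y, hy, -⟩ := hφ.surjOn hz
    exact ⟨y, hy⟩
  obtain ⟨_, _⟩ := isDomain_domainRing hY hYne
  have hker : ∀ P, pullback Y φ P = 0 ↔ P ∈ vanishingIdeal ℝ Z := fun P => by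
    rw [pullback_eq_zero_iff hY.isAlgebraic hφ, hM]
  let Φ : CoordRing Z →ₐ[ℝ] DomainRing Y φ :=
    Ideal.Quotient.liftₐ _ (pullback Y φ) fun P hP => (hker P).mpr hP
  have hΦ : ∀ P, Φ (Ideal.Quotient.mk _ P) = pullback Y φ P := fun P => rfl
  let := Φ.toRingHom.toAlgebra
  have : FaithfulSMul (CoordRing Z) (DomainRing Y φ) := by
    refine (faithfulSMul_iff_algebraMap_injective _ _).mpr
      ((injective_iff_map_eq_zero (algebraMap (CoordRing Z) (DomainRing Y φ))).mpr fun a ha => ?_)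
    obtain ⟨P, rfl⟩ := Ideal.Quotient.mk_surjective a
    exact Ideal.Quotient.eq_zero_iff_mem.mpr ((hker P).mp ha)
  have : IsScalarTower ℝ (CoordRing Z) (DomainRing Y φ) :=
    IsScalarTower.of_algebraMap_eq fun x => (Φ.commutes x).symm
  have : Algebra.FiniteType (CoordRing Y) (DomainRing Y φ) :=
    IsLocalization.finiteType_of_monoid_fg (Submonoid.powers
      (Ideal.Quotient.mk (vanishingIdeal ℝ Y) (commonDen φ))) _
  have : Algebra.FiniteType ℝ (DomainRing Y φ) :=
    Algebra.FiniteType.trans (S := CoordRing Y) inferInstance inferInstance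
  have : Algebra.FiniteType (CoordRing Z) (DomainRing Y φ) :=
    Algebra.FiniteType.of_restrictScalars_finiteType ℝ _ _
  have : Algebra.IsAlgebraic (CoordRing Y) (DomainRing Y φ) :=
    IsLocalization.isAlgebraic _ (Submonoid.powers
      (Ideal.Quotient.mk (vanishingIdeal ℝ Y) (commonDen φ)))
  -- Localization does not change the transcendence degree, so both rings have degree `d` and the
  -- extension is algebraic.
  have htr : Algebra.trdeg ℝ (DomainRing Y φ) = d := by
    rw [trdeg_eq_of_isAlgebraic ℝ (CoordRing Y) (DomainRing Y φ)]
    exact ringKrullDim_eq_trdeg ℝ (CoordRing Y) hYd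
  have : Algebra.IsAlgebraic (CoordRing Z) (DomainRing Y φ) :=
    isAlgebraic_of_trdeg_eq (ringKrullDim_eq_trdeg ℝ (CoordRing Z) hZd) htr
  have : CharZero (CoordRing Z) := algebraRat.charZero _
  -- Real points of the extension over `z` are the points of the fibre of `φ` over `z`; for `z ∈ M`
  -- there is exactly one, by bijectivity.
  have hover : ∀ {z : Fin m → ℝ} (hz : z ∈ Z) (γ : DomainRing Y φ →+* ℝ),
      γ.comp (algebraMap (CoordRing Z) (DomainRing Y φ)) = evalAt hz ↔
        φ.toFun (toPoint γ) = z := by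
    intro z hz γ
    constructor
    · intro h
      ext i
      have h1 := RingHom.congr_fun h (Ideal.Quotient.mk _ (X i))
      rw [evalAt_mk, eval_X] at h1
      rw [← h1]
      exact ((apply_pullback hY.isAlgebraic γ (X i)).trans (eval_X i)).symm
    · intro h
      refine Ideal.Quotient.ringHom_ext (RingHom.ext fun P => ?_)
      refine (apply_pullback hY.isAlgebraic γ P).trans ?_
      rw [h]
      exact (evalAt_mk hz P).symm
  obtain ⟨h, hh, hpt⟩ := exists_real_point_over (CoordRing Z) (DomainRing Y φ)
  obtain ⟨z, hz, hzh⟩ := exists_evalAt_ne_zero hMZ hM hh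
  obtain ⟨w, hw, hwh⟩ := exists_evalAt_ne_zero hNZ hN hh
  obtain ⟨γ, hγ⟩ := hpt _ _ hzh hwh (by
    obtain ⟨y, hy, hyz⟩ := hφ.surjOn hz
    refine ⟨domainEval hy, (hover _ _).mpr (by rw [toPoint_domainEval, hyz]), fun γ hγ => ?_⟩
    apply toPoint_injective
    rw [toPoint_domainEval]
    exact hφ.injOn (toPoint_mem hY.isAlgebraic γ) hy (((hover _ _).mp hγ).trans hyz.symm))
  refine ⟨w, hw, ?_⟩
  rw [← (hover _ _).mp hγ]
  exact hφ.mapsTo (toPoint_mem hY.isAlgebraic γ)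

end RealAlg

theorem lemma6p2 {m p d : ℕ} (Z M : Set (Fin m → ℝ)) (Y : Set (Fin p → ℝ))
    (φ : RealAlg.RationalMap p m)
    (hZirr : RealAlg.IsIrreducibleAlgebraicSet Z)
    (hZns : RealAlg.IsNonsingular Z)
    (hM : RealAlg.IsConnectedComponentOf M Z)
    (hMd : RealAlg.dim M = d)
    (hMmax : ∀ N : Set (Fin m → ℝ), RealAlg.IsConnectedComponentOf N Z →
      RealAlg.dim N ≤ RealAlg.dim M)
    (hY : RealAlg.IsIrreducibleAlgebraicSet Y)
    (hYd : RealAlg.dim Y = d)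
    (hφ : Set.BijOn (RealAlg.RationalMap.toFun φ) (Y ∩ RealAlg.RationalMap.domain φ) M) :
    ∀ N : Set (Fin m → ℝ), RealAlg.IsConnectedComponentOf N Z → RealAlg.dim N = d → N = M := by
  intro N hN hNd
  have hsub : ∀ {S : Set (Fin m → ℝ)}, RealAlg.IsConnectedComponentOf S Z → S ⊆ Z := by
    rintro S ⟨x, -, rfl⟩
    exact connectedComponentIn_subset Z x
  obtain ⟨C, hC, hCZ⟩ := RealAlg.exists_component_vanishingIdeal_eq hZirr
  -- The dense component `C` has the dimension of `Z`, and maximality bounds it by `dim M`.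
  have hZd : RealAlg.dim Z = d := by
    refine le_antisymm ?_ (hMd ▸ RealAlg.dim_le_of_subset (hsub hM))
    have hCd : RealAlg.dim C = RealAlg.dim Z := by rw [RealAlg.dim, RealAlg.dim, hCZ]
    rw [← hCd, ← hMd]
    exact hMmax C hC
  obtain ⟨z, hzN, hzM⟩ := RealAlg.inter_nonempty_of_bijOn hZirr hZd (hsub hM)
    (RealAlg.vanishingIdeal_eq_of_dim_eq hZirr (hsub hM) hMd hZd) (hsub hN)
    (RealAlg.vanishingIdeal_eq_of_dim_eq hZirr (hsub hN) hNd hZd) hY hYd hφ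
  obtain ⟨x, -, rfl⟩ := hN
  obtain ⟨y, -, rfl⟩ := hM
  rw [connectedComponentIn_eq hzN, connectedComponentIn_eq hzM]
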